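/- Let ${\cal C}$ be a monoidal category and let $A$ be an object of ${\cal C}$. A *braided monoid structure* on $A$ consists of a monoid structure $\mu:A\otimes A\to A$, $\iota:1\to A$ together with an isomorphism $R:A\otimes A\to A\otimes A$ satisfying the Yang–Baxter equation $(R\otimes I)(I\otimes R)(R\otimes I)=(I\otimes R)(R\otimes I)(I\otimes R)$ and the conditions $$R(\iota\otimes I)=I\otimes\iota,\quad R(I\otimes\iota)=\iota\otimes I,$$ $$R(I\otimes\mu)=(\mu\otimes I)(I\otimes R)(R\otimes I),\quad R(\mu\otimes I)=(I\otimes\mu)(R\otimes I)(I\otimes R)$$ (associativity and unit constraints of ${\cal C}$ are suppressed; no condition $\mu R=\mu$ is imposed). Write $[n]=\{1,\dots,n\}$ for $n\ge 0$. A *semi-cosimplicial complex of monoids* $A^*$ in ${\cal C}$ is a functor $[n]\mapsto A^n$ from the category of the ordinals $[n]$, $n\geq 0$, and injective order preserving maps to the category of monoids in ${\cal C}$; it is *truncated of length 3* if it is only defined on $[0],[1],[2],[3]$. It satisfies the *covering condition* if for every $n$ and every finite (possibly empty) family $f_i:[n_i]\to[n]$, $i=1,\dots,m$, of injective order preserving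 maps (between ordinals on which $A^*$ is defined) with pairwise disjoint images whose union is $[n]$, the composite $$\bigotimes_{i=1}^m A^{n_i}\xrightarrow{\ \otimes_i A^{f_i}\ }(A^n)^{\otimes m}\xrightarrow{\ mult\ }A^n$$ is an isomorphism in ${\cal C}$, where $mult$ is the iterated multiplication of $A^n$ (the unit map if $m=0$). Theorem. The following data are equivalent: (0) a braided monoid structure on $A$; (i) a semi-cosimplicial complex of monoids $A^*$ in ${\cal C}$ with $A^1=A$, satisfying the covering condition; (ii) a length 3 truncated semi-cosimplicial complex of monoids $A^*$ in ${\cal C}$ with $A^1=A$, satisfying the covering condition. Precisely: consider the category of complexes as in (i) (respectively (ii)) equipped with an isomorphism $A^1\cong A$ in ${\cal C}$, whose morphisms are the maps of semi-cosimplicial (respectively truncated semi-cosimplicial) monoids compatible with these isomorphisms. Each of these two categories is equivalent to the discrete category on the set of braided monoid structures on $A$. The equivalences send $A^*$ to a braided monoid structure with the monoid structure of $A^1$ and with $R$ satisfying $\mu_{A^2}(\partial_0\otimes\partial_1)\,R=\mu_{A^2}(\partial_1\otimes\partial_0)$, where $\partial_0,\partial_1:A^1\to A^2$ are induced by the maps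 $[1]\to[2]$ with images $\{2\}$ and $\{1\}$ respectively. Truncation from (i) to (ii) is an equivalence of categories, compatible with the two equivalences. -/

import Mathlib

open CategoryTheory MonoidalCategory

universe v u

namespace SemiCosimplicial

/-! ### The indexing category of finite ordinals and injective monotone maps -/

/-- The objects are the finite ordinals `[n] = {1, …, n}` with `0 ≤ n ≤ N`.
For `N = ⊤` these are all finite ordinals, for `N = 3` they are `[0], [1], [2], [3]`. -/
structure OrdInj (N : ℕ∞) where
  /-- the number of elements -/
  len : ℕ
  le : (len : ℕ∞) ≤ N

/-- The morphisms are the injective order preserving maps (the set `{1, …, n}` is modelled by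
`Fin n`). -/
instance (N : ℕ∞) : Category (OrdInj N) where
  Hom a b := Fin a.len ↪o Fin b.len
  id a := RelEmbedding.refl _
  comp f g := f.trans g

/-- The underlying map of finite ordinals of a morphism. -/
def OrdInj.Hom.toEmb {N : ℕ∞} {a b : OrdInj N} (f : a ⟶ b) : Fin a.len ↪o Fin b.len := f

instance : Fact ((2 : ℕ∞) ≤ ⊤) := ⟨le_top⟩

instance : Fact ((2 : ℕ∞) ≤ 3) := ⟨by norm_num⟩

section
variable (N : ℕ∞) [h : Fact (2 ≤ N)]

/-- The object `[1]`. -/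
abbrev OrdInj.one : OrdInj N := ⟨1, le_trans (by norm_num) h.out⟩

/-- The object `[2]`. -/
abbrev OrdInj.two : OrdInj N := ⟨2, by simpa using h.out⟩

/-- The map `∂ᵢ : [1] ⟶ [2]`, `i = 0, 1`: the injection whose image omits the `i`-th element
(counted from zero) of the two-element ordinal. -/
def OrdInj.d (i : Fin 2) : OrdInj.one N ⟶ OrdInj.two N := Fin.succAboveOrderEmb i

end

/-- The inclusion of the ordinals of length at most `3` into all finite ordinals. -/
def OrdInj.incl : OrdInj 3 ⥤ OrdInj ⊤ where
  obj a := ⟨a.len, le_top⟩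
  map f := f

variable {C : Type u} [Category.{v} C] [MonoidalCategory C]

/-! ### Iterated tensor products and iterated multiplication -/

/-- The tensor product `X₁ ⊗ … ⊗ Xₘ` (the monoidal unit for `m = 0`). -/
def tensorFamily : (m : ℕ) → (Fin m → C) → C
  | 0, _ => 𝟙_ C
  | m + 1, X => X 0 ⊗ tensorFamily m (fun i => X i.succ)

/-- The tensor product `g₁ ⊗ … ⊗ gₘ` of morphisms. -/
def tensorFamilyHom : (m : ℕ) → {X Y : Fin m → C} → (∀ i, X i ⟶ Y i) →
    (tensorFamily m X ⟶ tensorFamily m Y)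
  | 0, _, _, _ => 𝟙 _
  | m + 1, _, _, g => g 0 ⊗ₘ tensorFamilyHom m (fun i => g i.succ)

/-- The iterated multiplication `B ⊗ … ⊗ B ⟶ B` of a monoid `B` (the unit map for zero
factors). -/
def iteratedMul (B : C) [MonObj B] : (m : ℕ) → (tensorFamily m (fun _ => B) ⟶ B)
  | 0 => MonObj.one
  | m + 1 => (B ◁ iteratedMul B m) ≫ MonObj.mul

/-! ### Semi-cosimplicial monoids and the covering condition -/

/-- Semi-cosimplicial monoids in `C`, truncated to the levels `n ≤ N`; untruncated if `N = ⊤`. -/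
abbrev SemiCosimplicialMon (N : ℕ∞) (C : Type u) [Category.{v} C] [MonoidalCategory C] :=
  OrdInj N ⥤ Mon C

/-- A finite family of injective monotone maps `fᵢ : [nᵢ] ⟶ [n]` with pairwise disjoint images
whose union is `[n]`. -/
def IsCoveringFamily {N : ℕ∞} {n : OrdInj N} {m : ℕ} {k : Fin m → OrdInj N}
    (f : ∀ i, k i ⟶ n) : Prop :=
  (∀ i j, i ≠ j →
    Disjoint (Set.range (OrdInj.Hom.toEmb (f i))) (Set.range (OrdInj.Hom.toEmb (f j)))) ∧
  (⋃ i, Set.range (OrdInj.Hom.toEmb (f i))) = Set.univ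

/-- The map `⨂ᵢ M^{nᵢ} ⟶ (M^n)^{⊗ m} ⟶ M^n` attached to a family `fᵢ : [nᵢ] ⟶ [n]`. -/
def coveringMap {N : ℕ∞} (M : SemiCosimplicialMon N C) {n : OrdInj N} {m : ℕ}
    {k : Fin m → OrdInj N} (f : ∀ i, k i ⟶ n) :
    tensorFamily m (fun i => (M.obj (k i)).X) ⟶ (M.obj n).X :=
  tensorFamilyHom m (fun i => (M.map (f i)).hom) ≫ iteratedMul (M.obj n).X m

/-- The covering condition: every covering map is an isomorphism in `C`. -/
def CoveringCondition {N : ℕ∞} (M : SemiCosimplicialMon N C) : Prop :=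
  ∀ (n : OrdInj N) (m : ℕ) (k : Fin m → OrdInj N) (f : ∀ i, k i ⟶ n),
    IsCoveringFamily f → IsIso (coveringMap M f)

/-- A semi-cosimplicial monoid `A^*` (truncated to the levels `n ≤ N`) satisfying the covering
condition, with an identification of `A^1` with the object `A` of `C`. -/
structure CoveringComplex (N : ℕ∞) [Fact (2 ≤ N)] (A : C) where
  /-- the underlying semi-cosimplicial monoid -/
  toFunctor : SemiCosimplicialMon N C
  covering : CoveringCondition toFunctor
  /-- the identification of `A^1` with `A` -/
  φ : (toFunctor.obj (OrdInj.one N)).X ≅ A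

/-- Morphisms are the maps of semi-cosimplicial monoids that are the identity of `A` in
degree one. -/
@[ext]
structure CoveringComplex.Hom {N : ℕ∞} [Fact (2 ≤ N)] {A : C} (M M' : CoveringComplex N A) where
  /-- the map of semi-cosimplicial monoids -/
  toNatTrans : M.toFunctor ⟶ M'.toFunctor
  comm : (toNatTrans.app (OrdInj.one N)).hom ≫ M'.φ.hom = M.φ.hom

instance {N : ℕ∞} [Fact (2 ≤ N)] (A : C) : Category (CoveringComplex N A) where
  Hom M M' := CoveringComplex.Hom M M'
  id M := ⟨𝟙 _, by simp⟩
  comp f g := ⟨f.toNatTrans ≫ g.toNatTrans, by simp [f.comm, g.comm]⟩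
  id_comp f := CoveringComplex.Hom.ext (Category.id_comp _)
  comp_id f := CoveringComplex.Hom.ext (Category.comp_id _)
  assoc f g h := CoveringComplex.Hom.ext (Category.assoc _ _ _)

/-- Forgetting the levels above `3`. -/
def truncate (A : C) : CoveringComplex ⊤ A ⥤ CoveringComplex 3 A where
  obj M :=
    { toFunctor := OrdInj.incl ⋙ M.toFunctor
      covering := fun _ m k f hf =>
        M.covering _ m (fun i => OrdInj.incl.obj (k i)) (fun i => OrdInj.incl.map (f i)) hf
      φ := M.φ }
  map g := ⟨Functor.whiskerLeft OrdInj.incl g.toNatTrans, g.comm⟩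

/-! ### Braided monoids -/

/-- A structure of a braided monoid on an object `A`: a monoid structure together with a
Yang–Baxter operator compatible with the unit and the multiplication. Commutativity is not
required. The associativity and unit constraints are written out. -/
structure BraidedMonStruct (A : C) where
  /-- the monoid structure -/
  mon : MonObj A
  /-- the Yang–Baxter operator -/
  R : A ⊗ A ≅ A ⊗ A
  /-- `(R ⊗ I)(I ⊗ R)(R ⊗ I) = (I ⊗ R)(R ⊗ I)(I ⊗ R)` -/
  yang_baxter :
    (R.hom ▷ A) ≫ (α_ A A A).hom ≫ (A ◁ R.hom) ≫ (α_ A A A).inv ≫ (R.hom ▷ A) =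
      (α_ A A A).hom ≫ (A ◁ R.hom) ≫ (α_ A A A).inv ≫ (R.hom ▷ A) ≫
        (α_ A A A).hom ≫ (A ◁ R.hom) ≫ (α_ A A A).inv
  /-- `R(ι ⊗ I) = I ⊗ ι` -/
  one_left : (λ_ A).inv ≫ (mon.one ▷ A) ≫ R.hom = (ρ_ A).inv ≫ (A ◁ mon.one)
  /-- `R(I ⊗ ι) = ι ⊗ I` -/
  one_right : (ρ_ A).inv ≫ (A ◁ mon.one) ≫ R.hom = (λ_ A).inv ≫ (mon.one ▷ A)
  /-- `R(I ⊗ μ) = (μ ⊗ I)(I ⊗ R)(R ⊗ I)` -/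
  mul_right : (A ◁ mon.mul) ≫ R.hom =
    (α_ A A A).inv ≫ (R.hom ▷ A) ≫ (α_ A A A).hom ≫ (A ◁ R.hom) ≫ (α_ A A A).inv ≫
      (mon.mul ▷ A)
  /-- `R(μ ⊗ I) = (I ⊗ μ)(R ⊗ I)(I ⊗ R)` -/
  mul_left : (mon.mul ▷ A) ≫ R.hom =
    (α_ A A A).hom ≫ (A ◁ R.hom) ≫ (α_ A A A).inv ≫ (R.hom ▷ A) ≫ (α_ A A A).hom ≫
      (A ◁ mon.mul)

/-- The map `μ(∂ᵢ ⊗ ∂ⱼ) : A^1 ⊗ A^1 ⟶ A^2`, with `A^1` identified with `A`. -/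
def CoveringComplex.pairing {N : ℕ∞} [Fact (2 ≤ N)] {A : C} (M : CoveringComplex N A)
    (i j : Fin 2) : A ⊗ A ⟶ (M.toFunctor.obj (OrdInj.two N)).X :=
  ((M.φ.inv ≫ (M.toFunctor.map (OrdInj.d N i)).hom) ⊗ₘ
    (M.φ.inv ≫ (M.toFunctor.map (OrdInj.d N j)).hom)) ≫ MonObj.mul

/-- The complex `A^*` induces the braided monoid structure `B` on `A`: the monoid structure of `B`
is that of `A^1`, and `μ(∂₀ ⊗ ∂₁) R = μ(∂₁ ⊗ ∂₀)`. -/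
structure CoveringComplex.Induces {N : ℕ∞} [Fact (2 ≤ N)] {A : C} (M : CoveringComplex N A)
    (B : BraidedMonStruct A) : Prop where
  one : MonObj.one ≫ M.φ.hom = B.mon.one
  mul : MonObj.mul ≫ M.φ.hom = (M.φ.hom ⊗ₘ M.φ.hom) ≫ B.mon.mul
  braiding : B.R.hom ≫ M.pairing 0 1 = M.pairing 1 0

end SemiCosimplicial

/-!
Both categories of complexes turn out to be equivalent to a discrete one because a covering complex
`M` is rebuilt, up to a unique isomorphism, from its vertices `eᵢ : A ⟶ Mⁿ` (`M.vertex`), the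
monoid maps induced by the `n` maps `[1] ⟶ [n]`. Write `f ⊙ g : X ⊗ Y ⟶ P` for the product of
`f : X ⟶ P` and `g : Y ⟶ P` in a monoid `P`.

From a complex to a braided monoid. The covering condition on `[2]` makes `e₁ ⊙ e₂` and `e₂ ⊙ e₁`
isomorphisms `A ⊗ A ⟶ M²`, so there is a unique `R` with `R ≫ (e₂ ⊙ e₁) = e₁ ⊙ e₂`, and by
functoriality `R ≫ (eⱼ ⊙ eᵢ) = eᵢ ⊙ eⱼ` for `i < j` in every level. The laws of a braided monoid
hold because both sides agree after multiplying into `M²`, and for the Yang–Baxter equation into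
`M³` (`BraidedMonStruct.ofExchange`).

From a braided monoid to a complex. On `A^{⊗ n}` there are `n` left actions of `A`: the first is
the multiplication with the first factor, and the `i`-th moves its argument past the earlier
factors with the braiding (`letterAction`); to obtain a complex inducing `R` this is applied to the
braiding `R⁻¹`. By the laws of a braided monoid these are actions which satisfy the exchange
relation (`isExchangeAction_letterAction`). Letting the tensor
factors of `A^{⊗ n}` act successively on `A^{⊗ n}` defines a multiplication. Its associativity
follows from `letterAction_wordAction`: for any object `Z` with `n` actions satisfying the exchange
relation, the map `A^{⊗ n} ⊗ Z ⟶ Z` of successive actions is equivariant. The resulting monoid is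
universal among the monoids with `n` maps from `A` that satisfy the exchange relation (`lift`,
`powMon_hom_ext`); this gives at once the functoriality in `[n]` and the comparison map with any
complex. The covering condition holds because a covering
family amounts to a rearrangement of the product `e₁ ⊙ ⋯ ⊙ eₙ`, which is the identity of
`A^{⊗ n}`, and each transposition of neighbours changes the product by the braiding or its inverse
(`isListProd_of_perm`).

A map of complexes is invertible, by naturality of the covering maps of the families of vertices
(`CoveringComplex.isIso_hom`), and is determined by its values on vertices
(`CoveringComplex.hom_ext`). Hence the functor to the discrete category is fully faithful, and it
is essentially surjective because the complex of powers induces the given structure. The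
construction is uniform in the truncation level `N ≥ 3`, so that truncation is an equivalence by
two-out-of-three.
-/

open CategoryTheory MonoidalCategory

namespace SemiCosimplicial

variable {C : Type u} [Category.{v} C] [MonoidalCategory C]

open MonObj

/-! ### Actions of a braided monoid and the powers of its underlying object -/

/-- A family of left actions `aᵢ : A ⊗ Z ⟶ Z` of the monoid `A` of `B` on `Z` such that acting with
`aᵢ` and then with `aⱼ`, where `i < j`, is the same as braiding the two arguments and acting with
`aⱼ` and then with `aᵢ`. -/
structure IsExchangeAction {A : C} (B : BraidedMonStruct A) {n : ℕ} {Z : C}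
    (a : Fin n → (A ⊗ Z ⟶ Z)) : Prop where
  one (i : Fin n) : B.mon.one ▷ Z ≫ a i = (λ_ Z).hom
  mul (i : Fin n) : B.mon.mul ▷ Z ≫ a i = (α_ A A Z).hom ≫ A ◁ a i ≫ a i
  comm (i j : Fin n) (hij : i < j) : A ◁ a i ≫ a j =
    (α_ A A Z).inv ≫ B.R.hom ▷ Z ≫ (α_ A A Z).hom ≫ A ◁ a j ≫ a i

/-- The tensor power `A ⊗ (A ⊗ (⋯ ⊗ 𝟙_ C))` with `n` factors `A`. -/
def pow (A : C) : ℕ → C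
  | 0 => 𝟙_ C
  | n + 1 => A ⊗ pow A n

/-- The factors of `A^{⊗ n}` act successively on `Z`, the last one first and the first one, through
`a 0`, last. -/
def wordAction {A Z : C} : (n : ℕ) → (Fin n → (A ⊗ Z ⟶ Z)) → (pow A n ⊗ Z ⟶ Z)
  | 0, _ => (λ_ Z).hom
  | n + 1, a => (α_ A (pow A n) Z).hom ≫ A ◁ wordAction n (fun i => a i.succ) ≫ a 0

lemma wordAction_succ {A Z : C} {n : ℕ} (a : Fin (n + 1) → (A ⊗ Z ⟶ Z)) :
    wordAction (n + 1) a =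
      (α_ A (pow A n) Z).hom ≫ A ◁ wordAction n (fun i => a i.succ) ≫ a 0 := rfl

/-- The tensor power of the unit of the monoid. -/
def powUnit {A : C} (B : BraidedMonStruct A) : (n : ℕ) → (𝟙_ C ⟶ pow A n)
  | 0 => 𝟙 _
  | n + 1 => B.mon.one ≫ (ρ_ A).inv ≫ A ◁ powUnit B n

/-- The `i`-th left action of `A` on `A^{⊗ n}`: the braiding moves the argument past the first `i`
factors (counting from zero), and then it is multiplied with the next one. -/
def letterAction {A : C} (B : BraidedMonStruct A) :
    (n : ℕ) → Fin n → (A ⊗ pow A n ⟶ pow A n)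
  | 0 => Fin.elim0
  | n + 1 => Fin.cases ((α_ A A (pow A n)).inv ≫ B.mon.mul ▷ pow A n)
      (fun i => (α_ A A (pow A n)).inv ≫ B.R.hom ▷ pow A n ≫ (α_ A A (pow A n)).hom ≫
        A ◁ letterAction B n i)

section
variable {A : C} (B : BraidedMonStruct A)

lemma letterAction_zero (n : ℕ) : letterAction B (n + 1) 0 =
    (α_ A A (pow A n)).inv ≫ B.mon.mul ▷ pow A n := rfl

lemma letterAction_succ {n : ℕ} (i : Fin n) : letterAction B (n + 1) i.succ =
    (α_ A A (pow A n)).inv ≫ B.R.hom ▷ pow A n ≫ (α_ A A (pow A n)).hom ≫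
      A ◁ letterAction B n i := rfl

lemma one_whiskerRight_R : B.mon.one ▷ A ≫ B.R.hom = (λ_ A).hom ≫ (ρ_ A).inv ≫ A ◁ B.mon.one := by
  rw [← B.one_left]; simp

lemma whiskerLeft_one_R : A ◁ B.mon.one ≫ B.R.hom = (ρ_ A).hom ≫ (λ_ A).inv ≫ B.mon.one ▷ A := by
  rw [← B.one_right]; simp

/-- The braided monoid axioms enter here: `one_left` and `mul_left` make each `letterAction` an
action, `mul_right` and the Yang–Baxter equation give the exchange relation for `i = 0` and for
`i > 0`. -/
theorem isExchangeAction_letterAction (n : ℕ) : IsExchangeAction B (letterAction B n) := by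
  induction n with
  | zero => exact ⟨fun i => i.elim0, fun i => i.elim0, fun i => i.elim0⟩
  | succ n ih =>
    refine ⟨?_, ?_, ?_⟩
    · refine Fin.cases ?_ fun i => ?_
      · rw [letterAction_zero]
        change (B.mon.one ▷ (A ⊗ pow A n)) ≫ _ = (λ_ (A ⊗ pow A n)).hom
        calc _ = (α_ _ _ _).inv ≫ (B.mon.one ▷ A ≫ B.mon.mul) ▷ pow A n := by monoidal
          _ = _ := by rw [B.mon.one_mul]; monoidal
      · rw [letterAction_succ]
        calc _ = (α_ _ _ _).inv ≫ (B.mon.one ▷ A ≫ B.R.hom) ▷ pow A n ≫ (α_ A A (pow A n)).hom ≫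
              A ◁ letterAction B n i := by change (B.mon.one ▷ (A ⊗ pow A n)) ≫ _ = _; monoidal
          _ = 𝟙 _ ⊗≫ A ◁ (B.mon.one ▷ pow A n ≫ letterAction B n i) := by
              rw [one_whiskerRight_R]; monoidal
          _ = _ := by
              rw [ih.one]; change _ = (λ_ (A ⊗ pow A n)).hom; monoidal
    · refine Fin.cases ?_ fun i => ?_
      · rw [letterAction_zero]
        calc _ = (α_ _ _ _).inv ≫ (B.mon.mul ▷ A ≫ B.mon.mul) ▷ pow A n := by
              change (B.mon.mul ▷ (A ⊗ pow A n)) ≫ _ = _; monoidal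
          _ = _ := by
              rw [B.mon.mul_assoc]
              change _ = (α_ A A (A ⊗ pow A n)).hom ≫ _
              monoidal
      · rw [letterAction_succ]
        calc _ = (α_ _ _ _).inv ≫ (B.mon.mul ▷ A ≫ B.R.hom) ▷ pow A n ≫ (α_ A A (pow A n)).hom ≫
              A ◁ letterAction B n i := by change (B.mon.mul ▷ (A ⊗ pow A n)) ≫ _ = _; monoidal
          _ = 𝟙 _ ⊗≫ A ◁ B.R.hom ▷ pow A n ⊗≫ B.R.hom ▷ A ▷ pow A n ⊗≫
                A ◁ (B.mon.mul ▷ pow A n ≫ letterAction B n i) := by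
              rw [B.mul_left]; monoidal
          _ = 𝟙 _ ⊗≫ A ◁ B.R.hom ▷ pow A n ⊗≫
                (B.R.hom ▷ (A ⊗ pow A n) ≫ (A ⊗ A) ◁ letterAction B n i) ⊗≫
                A ◁ letterAction B n i := by
              rw [ih.mul]; monoidal
          _ = _ := by
              rw [← whisker_exchange]
              change _ = (α_ A A (A ⊗ pow A n)).hom ≫ _
              monoidal
    · intro i j hij
      induction j using Fin.cases with
      | zero => simp at hij
      | succ j =>
      induction i using Fin.cases with
      | zero =>
        rw [letterAction_zero, letterAction_succ]
        change A ◁ _ ≫ _ = (α_ A A (A ⊗ pow A n)).inv ≫ B.R.hom ▷ (A ⊗ pow A n) ≫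
          (α_ A A (A ⊗ pow A n)).hom ≫ _
        calc _ = 𝟙 _ ⊗≫ (A ◁ B.mon.mul ≫ B.R.hom) ▷ pow A n ⊗≫ A ◁ letterAction B n j := by
              monoidal
          _ = 𝟙 _ ⊗≫ B.R.hom ▷ A ▷ pow A n ⊗≫ A ◁ B.R.hom ▷ pow A n ⊗≫
              (B.mon.mul ▷ (A ⊗ pow A n) ≫ A ◁ letterAction B n j) := by
              rw [B.mul_right]; monoidal
          _ = _ := by
              rw [← whisker_exchange]; monoidal
      | succ i =>
        rw [letterAction_succ, letterAction_succ]
        change A ◁ _ ≫ _ = (α_ A A (A ⊗ pow A n)).inv ≫ B.R.hom ▷ (A ⊗ pow A n) ≫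
          (α_ A A (A ⊗ pow A n)).hom ≫ _
        calc _ = 𝟙 _ ⊗≫ A ◁ B.R.hom ▷ pow A n ⊗≫ ((A ⊗ A) ◁ letterAction B n i ≫
                B.R.hom ▷ pow A n) ⊗≫ A ◁ letterAction B n j := by
              monoidal
          _ = 𝟙 _ ⊗≫ A ◁ B.R.hom ▷ pow A n ⊗≫ B.R.hom ▷ A ▷ pow A n ⊗≫
                A ◁ (A ◁ letterAction B n i ≫ letterAction B n j) := by
              rw [whisker_exchange]; monoidal
          _ = (α_ A A (A ⊗ pow A n)).inv ≫ (α_ (A ⊗ A) A (pow A n)).inv ≫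
                ((α_ A A A).hom ≫ (A ◁ B.R.hom) ≫ (α_ A A A).inv ≫ (B.R.hom ▷ A) ≫
                  (α_ A A A).hom ≫ (A ◁ B.R.hom) ≫ (α_ A A A).inv) ▷ pow A n ⊗≫
                A ◁ A ◁ letterAction B n j ⊗≫ A ◁ letterAction B n i := by
              rw [ih.comm i j (by simpa using hij)]; monoidal
          _ = 𝟙 _ ⊗≫ B.R.hom ▷ A ▷ pow A n ⊗≫ A ◁ B.R.hom ▷ pow A n ⊗≫
                (B.R.hom ▷ (A ⊗ pow A n) ≫ (A ⊗ A) ◁ letterAction B n j) ⊗≫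
                A ◁ letterAction B n i := by
              rw [← B.yang_baxter]; monoidal
          _ = _ := by
              rw [← whisker_exchange]; monoidal

lemma wordAction_naturality {Z Z' : C} {n : ℕ} {a : Fin n → (A ⊗ Z ⟶ Z)}
    {a' : Fin n → (A ⊗ Z' ⟶ Z')} (g : Z ⟶ Z') (h : ∀ i, a i ≫ g = A ◁ g ≫ a' i) :
    wordAction n a ≫ g = pow A n ◁ g ≫ wordAction n a' := by
  induction n with
  | zero => exact (leftUnitor_naturality g).symm
  | succ n ih =>
    rw [wordAction_succ, wordAction_succ]
    change ((α_ A (pow A n) Z).hom ≫ (A ◁ _) ≫ a 0) ≫ g = (A ⊗ pow A n) ◁ _ ≫ _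
    rw [Category.assoc, Category.assoc, h, ← whiskerLeft_comp_assoc, ih fun i => h i.succ]
    monoidal

lemma wordAction_tensor {Z : C} (Y : C) {n : ℕ} (a : Fin n → (A ⊗ Z ⟶ Z)) :
    wordAction n (fun i => (α_ A Z Y).inv ≫ a i ▷ Y) =
      (α_ (pow A n) Z Y).inv ≫ wordAction n a ▷ Y := by
  induction n with
  | zero => change (λ_ _).hom = (α_ (𝟙_ C) Z Y).inv ≫ (λ_ _).hom ▷ Y; simp
  | succ n ih =>
    simp only [wordAction_succ, ih]
    change _ = (α_ (A ⊗ pow A n) Z Y).inv ≫ _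
    monoidal

variable {B} in
lemma IsExchangeAction.succ {Z : C} {n : ℕ} {a : Fin (n + 1) → (A ⊗ Z ⟶ Z)}
    (h : IsExchangeAction B a) : IsExchangeAction B fun i => a i.succ :=
  ⟨fun i => h.one i.succ, fun i => h.mul i.succ,
    fun i j hij => h.comm i.succ j.succ (by simpa using hij)⟩

variable {B} in
/-- `wordAction n a : A^{⊗ n} ⊗ Z ⟶ Z` is equivariant for each of the `n` actions. -/
theorem letterAction_wordAction {Z : C} {n : ℕ} {a : Fin n → (A ⊗ Z ⟶ Z)}
    (h : IsExchangeAction B a) (i : Fin n) :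
    letterAction B n i ▷ Z ≫ wordAction n a =
      (α_ A (pow A n) Z).hom ≫ A ◁ wordAction n a ≫ a i := by
  induction n with
  | zero => exact i.elim0
  | succ n ih =>
    rw [wordAction_succ]
    induction i using Fin.cases with
    | zero =>
      rw [letterAction_zero]
      change ((α_ A A (pow A n)).inv ≫ B.mon.mul ▷ pow A n) ▷ Z ≫ _ =
        (α_ A (A ⊗ pow A n) Z).hom ≫ _
      calc _ = 𝟙 _ ⊗≫ (B.mon.mul ▷ (pow A n ⊗ Z) ≫ A ◁ wordAction n fun i => a i.succ) ⊗≫ a 0 := by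
            monoidal
        _ = 𝟙 _ ⊗≫ A ◁ A ◁ (wordAction n fun i => a i.succ) ⊗≫ B.mon.mul ▷ Z ≫ a 0 := by
            rw [← whisker_exchange]; monoidal
        _ = _ := by rw [h.mul]; monoidal
    | succ i =>
      rw [letterAction_succ]
      change ((α_ A A (pow A n)).inv ≫ B.R.hom ▷ pow A n ≫ (α_ A A (pow A n)).hom ≫
        A ◁ letterAction B n i) ▷ Z ≫ _ = (α_ A (A ⊗ pow A n) Z).hom ≫ _
      calc _ = 𝟙 _ ⊗≫ B.R.hom ▷ (pow A n) ▷ Z ⊗≫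
              A ◁ (letterAction B n i ▷ Z ≫ wordAction n fun i => a i.succ) ≫ a 0 := by
            monoidal
        _ = 𝟙 _ ⊗≫ (B.R.hom ▷ (pow A n ⊗ Z) ≫ (A ⊗ A) ◁ wordAction n fun i => a i.succ) ⊗≫
              A ◁ a i.succ ≫ a 0 := by
            rw [ih (h.succ)]; monoidal
        _ = 𝟙 _ ⊗≫ A ◁ A ◁ (wordAction n fun i => a i.succ) ⊗≫
              ((α_ A A Z).inv ≫ B.R.hom ▷ Z ≫ (α_ A A Z).hom ≫ A ◁ a i.succ ≫ a 0) := by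
            rw [← whisker_exchange]; monoidal
        _ = _ := by rw [← h.comm 0 i.succ i.succ_pos]; monoidal
end

/-! ### The monoid structure on the powers and its universal property -/

/-- The external product `X ⊗ Y ⟶ P` of `f : X ⟶ P` and `g : Y ⟶ P` in a monoid `P`. -/
def extMul {P : C} [MonObj P] {X Y : C} (f : X ⟶ P) (g : Y ⟶ P) : X ⊗ Y ⟶ P := (f ⊗ₘ g) ≫ μ

/-- The external product, right associative. -/
infixr:75 " ⊙ " => extMul

section extMul
variable {P Q : C} [MonObj P] [MonObj Q] {X X' Y Y' Z : C}

lemma extMul_assoc (f : X ⟶ P) (g : Y ⟶ P) (h : Z ⟶ P) :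
    (f ⊙ g) ⊙ h = (α_ X Y Z).hom ≫ (f ⊙ g ⊙ h) := by
  have h₁ : ((f ⊗ₘ g) ≫ μ) ⊗ₘ h = ((f ⊗ₘ g) ⊗ₘ h) ≫ μ ▷ P := by
    rw [← tensorHom_id, tensorHom_comp_tensorHom, Category.comp_id]
  have h₂ : f ⊗ₘ ((g ⊗ₘ h) ≫ μ) = (f ⊗ₘ (g ⊗ₘ h)) ≫ P ◁ μ := by
    rw [← id_tensorHom, tensorHom_comp_tensorHom, Category.comp_id]
  rw [extMul, extMul, extMul, extMul, h₁, h₂, Category.assoc, Category.assoc, MonObj.mul_assoc,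
    associator_naturality_assoc]

lemma extMul_assoc' (f : X ⟶ P) (g : Y ⟶ P) (h : Z ⟶ P) :
    f ⊙ g ⊙ h = (α_ X Y Z).inv ≫ ((f ⊙ g) ⊙ h) := by
  simp [extMul_assoc]

lemma extMul_comp (f : X ⟶ P) (g : Y ⟶ P) (h : P ⟶ Q) [IsMonHom h] :
    (f ⊙ g) ≫ h = (f ≫ h) ⊙ (g ≫ h) := by
  simp [extMul, IsMonHom.mul_hom]

lemma tensorHom_extMul (a : X' ⟶ X) (b : Y' ⟶ Y) (f : X ⟶ P) (g : Y ⟶ P) :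
    (a ⊗ₘ b) ≫ (f ⊙ g) = (a ≫ f) ⊙ (b ≫ g) := by
  simp [extMul]

lemma whiskerRight_extMul (a : X' ⟶ X) (f : X ⟶ P) (g : Y ⟶ P) :
    a ▷ Y ≫ (f ⊙ g) = (a ≫ f) ⊙ g := by
  simpa using tensorHom_extMul a (𝟙 Y) f g

lemma whiskerLeft_extMul (b : Y' ⟶ Y) (f : X ⟶ P) (g : Y ⟶ P) :
    X ◁ b ≫ (f ⊙ g) = f ⊙ (b ≫ g) := by
  simpa using tensorHom_extMul (𝟙 X) b f g

lemma one_extMul (f : X ⟶ P) : η[P] ⊙ f = (λ_ X).hom ≫ f := MonObj.one_mul_hom f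

lemma extMul_one (f : X ⟶ P) : f ⊙ η[P] = (ρ_ X).hom ≫ f := MonObj.mul_one_hom f

lemma mul_comp_eq_extMul (f : P ⟶ Q) [IsMonHom f] : μ ≫ f = f ⊙ f := IsMonHom.mul_hom f

end extMul

/-- The underlying monoid of a braided monoid. -/
abbrev BraidedMonStruct.toMon {A : C} (B : BraidedMonStruct A) : Mon C := { X := A, mon := B.mon }

section
variable {A : C} {B : BraidedMonStruct A}

lemma powUnit_wordAction {Z : C} {n : ℕ} {a : Fin n → (A ⊗ Z ⟶ Z)} (h : IsExchangeAction B a) :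
    powUnit B n ▷ Z ≫ wordAction n a = (λ_ Z).hom := by
  induction n with
  | zero => change 𝟙 _ ▷ Z ≫ (λ_ Z).hom = _; simp
  | succ n ih =>
    rw [wordAction_succ]
    change (B.mon.one ≫ (ρ_ A).inv ≫ A ◁ powUnit B n) ▷ Z ≫ _ = _
    calc _ = 𝟙 _ ⊗≫ B.mon.one ▷ Z ⊗≫ A ◁ (powUnit B n ▷ Z ≫ wordAction n fun i => a i.succ) ≫ a 0
          := by monoidal
      _ = 𝟙 _ ⊗≫ B.mon.one ▷ Z ≫ a 0 := by rw [ih (h.succ)]; monoidal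
      _ = _ := by rw [h.one]; monoidal

/-- `wordAction n a` is an action of `A^{⊗ n}`: being equivariant, it commutes with the successive
actions of the letters. -/
lemma powMul_wordAction {Z : C} {n : ℕ} {a : Fin n → (A ⊗ Z ⟶ Z)} (h : IsExchangeAction B a) :
    wordAction n (letterAction B n) ▷ Z ≫ wordAction n a =
      (α_ _ _ Z).hom ≫ pow A n ◁ wordAction n a ≫ wordAction n a := by
  have := wordAction_naturality (a := fun i => (α_ A (pow A n) Z).inv ≫ letterAction B n i ▷ Z)
    (a' := a) (wordAction n a) (fun i => by simp [letterAction_wordAction h])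
  rw [wordAction_tensor] at this
  simp [← this]

variable (B) in
/-- The right unit law for the powers. In the inductive step, inserting a unit in front is an
equivariant map from `A^{⊗ n}` to `A^{⊗ (n + 1)}` with its actions of positive index. -/
lemma wordAction_letterAction_powUnit (n : ℕ) :
    pow A n ◁ powUnit B n ≫ wordAction n (letterAction B n) = (ρ_ _).hom := by
  induction n with
  | zero => 
    change 𝟙_ C ◁ 𝟙 (𝟙_ C) ≫ (λ_ (𝟙_ C)).hom = _
    simp [unitors_equal]; rfl
  | succ n ih =>
    have := wordAction_naturality (Z' := A ⊗ pow A n) (a := letterAction B n)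
      (a' := fun i => (α_ A A (pow A n)).inv ≫ B.R.hom ▷ pow A n ≫ (α_ A A (pow A n)).hom ≫
        A ◁ letterAction B n i)
      ((λ_ _).inv ≫ B.mon.one ▷ _) (fun i => by
        symm
        calc _ = 𝟙 _ ⊗≫ (A ◁ B.mon.one ≫ B.R.hom) ▷ pow A n ⊗≫ A ◁ letterAction B n i := by
              monoidal
          _ = 𝟙 _ ⊗≫ (B.mon.one ▷ (A ⊗ pow A n) ≫ A ◁ letterAction B n i) := by
              rw [whiskerLeft_one_R]; monoidal
          _ = _ := by rw [← whisker_exchange]; monoidal)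
    rw [wordAction_succ]
    change (A ⊗ pow A n) ◁ (B.mon.one ≫ (ρ_ A).inv ≫ A ◁ powUnit B n) ≫
      (α_ A (pow A n) (A ⊗ pow A n)).hom ≫ A ◁ wordAction (Z := A ⊗ pow A n) n
        (fun i => (α_ A A (pow A n)).inv ≫ B.R.hom ▷ pow A n ≫ (α_ A A (pow A n)).hom ≫
          A ◁ letterAction B n i) ≫ (α_ A A (pow A n)).inv ≫ B.mon.mul ▷ pow A n = _
    -- The unit of the next power is the previous one with the unit of `A` inserted in front.
    have key : B.mon.one ≫ (ρ_ A).inv ≫ A ◁ powUnit B n =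
        powUnit B n ≫ (λ_ (pow A n)).inv ≫ B.mon.one ▷ pow A n := by
      rw [rightUnitor_inv_naturality_assoc, ← unitors_inv_equal,
        leftUnitor_inv_naturality_assoc, ← whisker_exchange]
    rw [key]
    calc _ = 𝟙 _ ⊗≫ A ◁ pow A n ◁ powUnit B n ⊗≫ A ◁ (pow A n ◁ ((λ_ _).inv ≫ B.mon.one ▷ _) ≫
          wordAction (Z := A ⊗ pow A n) n
            (fun i => (α_ A A (pow A n)).inv ≫ B.R.hom ▷ pow A n ≫ (α_ A A (pow A n)).hom ≫
              A ◁ letterAction B n i)) ≫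
            (α_ A A (pow A n)).inv ≫ B.mon.mul ▷ pow A n := by monoidal
      _ = 𝟙 _ ⊗≫ A ◁ (pow A n ◁ powUnit B n ≫ wordAction n (letterAction B n)) ⊗≫
            (A ◁ B.mon.one ≫ B.mon.mul) ▷ pow A n := by rw [← this]; monoidal
      _ = _ := by
        rw [ih, B.mon.mul_one]; change _ = (ρ_ (A ⊗ pow A n)).hom; monoidal

variable (B) in
/-- The monoid structure on `A^{⊗ n}`, in which the factors of the left argument act successively
on the right argument. -/
def powMon (n : ℕ) : Mon C where
  X := pow A n
  mon :=
    { one := powUnit B n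
      mul := wordAction n (letterAction B n)
      one_mul := powUnit_wordAction (isExchangeAction_letterAction B n)
      mul_one := wordAction_letterAction_powUnit B n
      mul_assoc := powMul_wordAction (isExchangeAction_letterAction B n) }

variable (B) in
/-- The map `A ⟶ A^{⊗ n}` with values in the `i`-th factor and the unit in the other factors,
obtained by letting `A` act on the unit. -/
def letterHom (n : ℕ) (i : Fin n) : A ⟶ pow A n :=
  (ρ_ A).inv ≫ A ◁ powUnit B n ≫ letterAction B n i

lemma letterHom_whiskerRight_wordAction {n : ℕ} (i : Fin n) :
    letterHom B n i ▷ pow A n ≫ wordAction n (letterAction B n) = letterAction B n i := by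
  rw [letterHom]
  calc _ = 𝟙 _ ⊗≫ A ◁ powUnit B n ▷ pow A n ⊗≫ (letterAction B n i ▷ pow A n ≫
        wordAction n (letterAction B n)) := by monoidal
    _ = 𝟙 _ ⊗≫ A ◁ (powUnit B n ▷ pow A n ≫
          wordAction n (letterAction B n)) ≫ letterAction B n i := by
        rw [letterAction_wordAction (isExchangeAction_letterAction B n)]; monoidal
    _ = _ := by rw [powUnit_wordAction (isExchangeAction_letterAction B n)]; monoidal

lemma letterHom_extMul {n : ℕ} (i : Fin n) {X : C} (f : X ⟶ pow A n) :
    extMul (P := (powMon B n).X) (letterHom B n i) f = A ◁ f ≫ letterAction B n i := by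
  rw [← letterHom_whiskerRight_wordAction, whisker_exchange_assoc,
    ← MonoidalCategory.tensorHom_def_assoc]
  rfl

variable (B) in
/-- `letterHom` as a map of monoids. -/
def letter (n : ℕ) (i : Fin n) : B.toMon ⟶ powMon B n :=
  Mon.Hom.mk' (letterHom B n i)
    (by
      change B.mon.one ≫ (ρ_ A).inv ≫ A ◁ powUnit B n ≫ letterAction B n i = powUnit B n
      have := (isExchangeAction_letterAction B n).one i
      rw [rightUnitor_inv_naturality_assoc, ← unitors_inv_equal, ← whisker_exchange_assoc, this]
      simp)
    (by
      change B.mon.mul ≫ letterHom B n i =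
        extMul (P := (powMon B n).X) (letterHom B n i) (letterHom B n i)
      rw [letterHom_extMul, letterHom]
      have := (isExchangeAction_letterAction B n).mul i
      calc _ = 𝟙 _ ⊗≫ (B.mon.mul ▷ 𝟙_ C ≫ A ◁ powUnit B n) ≫ letterAction B n i := by monoidal
        _ = 𝟙 _ ⊗≫ A ◁ A ◁ powUnit B n ⊗≫ B.mon.mul ▷ pow A n ≫ letterAction B n i := by
          rw [← whisker_exchange]; monoidal
        _ = _ := by
          rw [this]
          monoidal)

/-- A family of maps of monoids `eᵢ : A ⟶ P` for which the product of `eⱼ` and `eᵢ` in this order,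
where `i < j`, is obtained from the product in the other order by the braiding. -/
def IsExchangeFamily {P : Mon C} {n : ℕ} (e : Fin n → (B.toMon ⟶ P)) : Prop :=
  ∀ i j, i < j → (e j).hom ⊙ (e i).hom = B.R.hom ≫ ((e i).hom ⊙ (e j).hom)

lemma isExchangeFamily_letter (n : ℕ) : IsExchangeFamily (letter B n) := fun i j hij => by
  change extMul (P := (powMon B n).X) (letterHom B n j) (letterHom B n i) =
    B.R.hom ≫ extMul (P := (powMon B n).X) (letterHom B n i) (letterHom B n j)
  rw [letterHom_extMul, letterHom_extMul]
  have := (isExchangeAction_letterAction B n).comm i j hij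
  simp only [letterHom]
  calc _ = 𝟙 _ ⊗≫ A ◁ A ◁ powUnit B n ⊗≫ (A ◁ letterAction B n i ≫ letterAction B n j) := by
        monoidal
    _ = 𝟙 _ ⊗≫ ((A ⊗ A) ◁ powUnit B n ≫ B.R.hom ▷ pow A n) ⊗≫
          A ◁ letterAction B n j ≫ letterAction B n i := by rw [this]; monoidal
    _ = _ := by
        rw [whisker_exchange]
        change _ = B.R.hom ≫ A ◁ ((ρ_ A).inv ≫ A ◁ powUnit B n ≫ letterAction B n j) ≫ _
        monoidal

/-- The left multiplications with the members of an exchange family. -/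
lemma IsExchangeFamily.isExchangeAction {P : Mon C} {n : ℕ} {e : Fin n → (B.toMon ⟶ P)}
    (h : IsExchangeFamily e) : IsExchangeAction B fun i => (e i).hom ⊙ 𝟙 P.X where
  one i := by
    have : B.mon.one ≫ (e i).hom = η := IsMonHom.one_hom (e i).hom
    rw [whiskerRight_extMul, this, one_extMul, Category.comp_id]
  mul i := by
    have : B.mon.mul ≫ (e i).hom = (e i).hom ⊙ (e i).hom := IsMonHom.mul_hom (e i).hom
    rw [whiskerRight_extMul, this, extMul_assoc, whiskerLeft_extMul, Category.comp_id]
  comm i j hij := by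
    rw [whiskerLeft_extMul, whiskerLeft_extMul, Category.comp_id, Category.comp_id,
      extMul_assoc', h i j hij, ← whiskerRight_extMul, extMul_assoc]

/-- The product `A^{⊗ n} ⟶ P` of a family of maps `A ⟶ P`, in increasing order. -/
def liftHom {P : C} [MonObj P] : (n : ℕ) → (Fin n → (A ⟶ P)) → (pow A n ⟶ P)
  | 0, _ => η[P]
  | n + 1, e => e 0 ⊙ liftHom n (fun i => e i.succ)

lemma wordAction_extMul_id {P : C} [MonObj P] {n : ℕ} (e : Fin n → (A ⟶ P)) :
    wordAction n (fun i => e i ⊙ 𝟙 P) = liftHom n e ⊙ 𝟙 P := by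
  induction n with
  | zero => exact ((one_extMul (𝟙 P)).trans (Category.comp_id _)).symm
  | succ n ih =>
    rw [wordAction_succ, ih, whiskerLeft_extMul, Category.comp_id]
    exact (extMul_assoc _ _ _).symm

lemma letterAction_liftHom {P : Mon C} {n : ℕ} {e : Fin n → (B.toMon ⟶ P)}
    (h : IsExchangeFamily e) (i : Fin n) :
    letterAction B n i ≫ liftHom n (fun i => (e i).hom) =
      A ◁ liftHom n (fun i => (e i).hom) ≫ ((e i).hom ⊙ 𝟙 P.X) := by
  have := letterAction_wordAction h.isExchangeAction i
  rw [wordAction_extMul_id, whiskerRight_extMul] at this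
  have := (ρ_ _).inv ≫= _ ◁ η[P.X] ≫= this
  rw [associator_naturality_right_assoc, ← whiskerLeft_comp_assoc, whiskerLeft_extMul,
    whiskerLeft_extMul, Category.comp_id, Category.comp_id, extMul_one, whiskerLeft_extMul,
    Category.comp_id, extMul_one, Iso.inv_hom_id_assoc] at this
  rw [this, whiskerLeft_extMul, Category.comp_id, ← whiskerLeft_extMul]
  simp

lemma powUnit_liftHom {P : Mon C} {n : ℕ} (e : Fin n → (B.toMon ⟶ P)) :
    powUnit B n ≫ liftHom n (fun i => (e i).hom) = η[P.X] := by
  induction n with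
  | zero => exact Category.id_comp _
  | succ n ih =>
    change (B.mon.one ≫ (ρ_ A).inv ≫ A ◁ powUnit B n) ≫ ((e 0).hom ⊙ _) = _
    have : B.mon.one ≫ (e 0).hom = η := IsMonHom.one_hom (e 0).hom
    simp [whiskerLeft_extMul, ih, extMul_one, this]

lemma powMul_liftHom {P : Mon C} {n : ℕ} {e : Fin n → (B.toMon ⟶ P)}
    (h : IsExchangeFamily e) :
    wordAction n (letterAction B n) ≫ liftHom n (fun i => (e i).hom) =
      liftHom n (fun i => (e i).hom) ⊙ liftHom n (fun i => (e i).hom) := by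
  rw [wordAction_naturality _ (letterAction_liftHom h), wordAction_extMul_id, whiskerLeft_extMul,
    Category.comp_id]

/-- The map of monoids `A^{⊗ n} ⟶ P` extending an exchange family. -/
def lift {P : Mon C} {n : ℕ} (e : Fin n → (B.toMon ⟶ P)) (h : IsExchangeFamily e) :
    powMon B n ⟶ P :=
  Mon.Hom.mk' (liftHom n fun i => (e i).hom) (powUnit_liftHom e) (powMul_liftHom h)

lemma letterHom_liftHom {P : Mon C} {n : ℕ} {e : Fin n → (B.toMon ⟶ P)}
    (h : IsExchangeFamily e) (i : Fin n) :
    letterHom B n i ≫ liftHom n (fun i => (e i).hom) = (e i).hom := by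
  rw [letterHom, Category.assoc, Category.assoc, letterAction_liftHom h,
    ← whiskerLeft_comp_assoc, powUnit_liftHom, whiskerLeft_extMul, Category.comp_id,
    extMul_one, Iso.inv_hom_id_assoc]

lemma letter_lift {P : Mon C} {n : ℕ} {e : Fin n → (B.toMon ⟶ P)}
    (h : IsExchangeFamily e) (i : Fin n) : letter B n i ≫ lift e h = e i :=
  Mon.Hom.ext' (letterHom_liftHom h i)

/-- A unital map `A^{⊗ n} ⟶ P` that turns the letter actions into left multiplications by a family
`e` is the product of this family, since every element of `A^{⊗ n}` is a word applied to the
unit. -/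
lemma eq_liftHom {P : C} [MonObj P] {n : ℕ} (e : Fin n → (A ⟶ P)) (g : pow A n ⟶ P)
    (one : powUnit B n ≫ g = η) (act : ∀ i, letterAction B n i ≫ g = A ◁ g ≫ (e i ⊙ 𝟙 P)) :
    g = liftHom n e := by
  have h2 := (ρ_ _).inv ≫= _ ◁ powUnit B n ≫= wordAction_naturality _ act
  have h4 := wordAction_letterAction_powUnit B n
  rw [wordAction_extMul_id, whiskerLeft_extMul, Category.comp_id, reassoc_of% h4,
    whiskerLeft_extMul, one, extMul_one, Iso.inv_hom_id_assoc, Iso.inv_hom_id_assoc] at h2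
  exact h2

lemma powMon_hom_eq {P : Mon C} {n : ℕ} (f : powMon B n ⟶ P) :
    f.hom = liftHom n fun i => (letter B n i ≫ f).hom :=
  eq_liftHom (B := B) _ _ (IsMonHom.one_hom f.hom) fun i => by
    have h₁ := letterHom_extMul (B := B) i (𝟙 (pow A n))
    rw [MonoidalCategory.whiskerLeft_id, Category.id_comp] at h₁
    have h₂ : extMul (P := (powMon B n).X) (letterHom B n i) (𝟙 (powMon B n).X) ≫ f.hom =
        (letter B n i ≫ f).hom ⊙ f.hom :=
      (extMul_comp _ _ _).trans (congrArg _ (Category.id_comp _))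
    have h₃ := whiskerLeft_extMul f.hom (letter B n i ≫ f).hom (𝟙 P.X)
    rw [Category.comp_id] at h₃
    exact ((congrArg (· ≫ f.hom) h₁).symm.trans h₂).trans h₃.symm

lemma powMon_hom_ext {P : Mon C} {n : ℕ} {f g : powMon B n ⟶ P}
    (h : ∀ i, letter B n i ≫ f = letter B n i ≫ g) : f = g :=
  Mon.Hom.ext' <| (powMon_hom_eq f).trans <|
    (congrArg (liftHom n) (funext fun i => congrArg _ (h i))).trans (powMon_hom_eq g).symm

end

/-! ### Products of lists and the covering condition for the powers -/

section listProd
variable {A P : C} [MonObj P]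

/-- The product `A^{⊗ n} ⟶ P` of a list of `n` maps `A ⟶ P`. -/
def listProd : (l : List (A ⟶ P)) → (pow A l.length ⟶ P)
  | [] => η[P]
  | x :: l => x ⊙ listProd l

/-- `f` is the product of the list `l`, up to an isomorphism of its source. -/
def IsListProd {X : C} (f : X ⟶ P) (l : List (A ⟶ P)) : Prop :=
  ∃ θ : X ≅ pow A l.length, f = θ.hom ≫ listProd l

lemma isListProd_listProd (l : List (A ⟶ P)) : IsListProd (listProd l) l :=
  ⟨Iso.refl _, (Category.id_comp _).symm⟩

lemma IsListProd.of_iso {X Y : C} {f : X ⟶ P} {l : List (A ⟶ P)} (h : IsListProd f l)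
    (θ : Y ≅ X) {g : Y ⟶ P} (hg : g = θ.hom ≫ f) : IsListProd g l := by
  obtain ⟨θ', rfl⟩ := h
  exact ⟨θ ≪≫ θ', by simp [hg]⟩

lemma IsListProd.trans {X : C} {f : X ⟶ P} {l l' : List (A ⟶ P)} (h : IsListProd f l)
    (h' : IsListProd (listProd l) l') : IsListProd f l' := by
  obtain ⟨θ, rfl⟩ := h
  exact h'.of_iso θ rfl

lemma IsListProd.cons (x : A ⟶ P) {X : C} {f : X ⟶ P} {l : List (A ⟶ P)} (h : IsListProd f l) :
    IsListProd (x ⊙ f) (x :: l) := by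
  obtain ⟨θ, rfl⟩ := h
  exact ⟨whiskerLeftIso A θ, (whiskerLeft_extMul _ _ _).symm⟩

lemma isListProd_append (l l' : List (A ⟶ P)) :
    IsListProd (listProd l ⊙ listProd l') (l ++ l') := by
  induction l with
  | nil => exact (isListProd_listProd l').of_iso (λ_ _) (one_extMul _)
  | cons x l ih => exact (ih.cons x).of_iso (α_ _ _ _) (extMul_assoc _ _ _)

lemma IsListProd.append {X Y : C} {f : X ⟶ P} {g : Y ⟶ P} {l l' : List (A ⟶ P)}
    (hf : IsListProd f l) (hg : IsListProd g l') : IsListProd (f ⊙ g) (l ++ l') := by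
  obtain ⟨θ, rfl⟩ := hf
  obtain ⟨θ', rfl⟩ := hg
  exact (isListProd_append l l').of_iso (tensorIso θ θ') (tensorHom_extMul _ _ _ _).symm

lemma isListProd_liftHom {n : ℕ} (e : Fin n → (A ⟶ P)) :
    IsListProd (liftHom n e) (List.ofFn e) := by
  induction n with
  | zero => rw [List.ofFn_zero]; exact isListProd_listProd []
  | succ n ih => rw [List.ofFn_succ]; exact (ih _).cons _

lemma tensorFamilyHom_iteratedMul_succ {m : ℕ} {X : Fin (m + 1) → C} (g : ∀ i, X i ⟶ P) :
    tensorFamilyHom (m + 1) g ≫ iteratedMul P (m + 1) =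
      g 0 ⊙ (tensorFamilyHom m (fun i => g i.succ) ≫ iteratedMul P m) := by
  change (g 0 ⊗ₘ _) ≫ (P ◁ iteratedMul P m ≫ μ) = (g 0 ⊗ₘ _) ≫ μ
  rw [← id_tensorHom, tensorHom_comp_tensorHom_assoc, Category.comp_id]

lemma isListProd_tensorFamilyHom {m : ℕ} {X : Fin m → C} (g : ∀ i, X i ⟶ P)
    (l : Fin m → List (A ⟶ P)) (h : ∀ i, IsListProd (g i) (l i)) :
    IsListProd (tensorFamilyHom m g ≫ iteratedMul P m) (List.ofFn l).flatten := by
  induction m with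
  | zero =>
    rw [List.ofFn_zero]
    exact (isListProd_listProd []).of_iso (Iso.refl _) rfl
  | succ m ih =>
    rw [List.ofFn_succ, tensorFamilyHom_iteratedMul_succ]
    exact (h 0).append (ih _ _ fun i => h i.succ)

lemma isListProd_swap {x y : A ⟶ P} (l : List (A ⟶ P)) (r : A ⊗ A ≅ A ⊗ A)
    (h : y ⊙ x = r.hom ≫ (x ⊙ y)) : IsListProd (listProd (y :: x :: l)) (x :: y :: l) := by
  refine (isListProd_listProd (x :: y :: l)).of_iso
    ((α_ A A _).symm ≪≫ whiskerRightIso r _ ≪≫ α_ A A _) ?_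
  change y ⊙ x ⊙ listProd l =
    ((α_ A A _).inv ≫ r.hom ▷ _ ≫ (α_ A A _).hom) ≫ (x ⊙ y ⊙ listProd l)
  rw [extMul_assoc', h, ← whiskerRight_extMul, extMul_assoc]
  simp

/-- The product of an exchange family over a list of indices does not depend on the order of the
list, up to an isomorphism of the source. -/
lemma isListProd_of_perm {I : Type*} [LinearOrder I] {e : I → (A ⟶ P)} (r : A ⊗ A ≅ A ⊗ A)
    (h : ∀ i j, i < j → e j ⊙ e i = r.hom ≫ (e i ⊙ e j)) {L L' : List I}
    (hL : L.Perm L') : IsListProd (listProd (L.map e)) (L'.map e) := by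
  induction hL with
  | nil => exact isListProd_listProd []
  | cons x _ ih => exact ih.cons (e x)
  | swap x y l =>
    rcases lt_trichotomy y x with hxy | rfl | hxy
    · exact isListProd_swap _ r.symm (by simp [h y x hxy])
    · exact isListProd_listProd _
    · exact isListProd_swap _ r (h x y hxy)
  | trans _ _ ih₁ ih₂ => exact ih₁.trans ih₂

lemma IsListProd.isIso {X Y : C} {f : X ⟶ P} {g : Y ⟶ P} {l : List (A ⟶ P)}
    (hf : IsListProd f l) (hg : IsListProd g l) (_ : IsIso g) : IsIso f := by
  obtain ⟨θ, rfl⟩ := hf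
  obtain ⟨θ', rfl⟩ := hg
  have : IsIso (listProd l) := IsIso.of_isIso_comp_left θ'.hom _
  infer_instance

end listProd

section
variable {A : C} (B : BraidedMonStruct A) (N : ℕ∞)

lemma isExchangeFamily_letter_emb {k n : ℕ} (f : Fin k ↪o Fin n) :
    IsExchangeFamily fun i => letter B n (f i) :=
  fun i j hij => isExchangeFamily_letter n (f i) (f j) (f.strictMono hij)

/-- The powers of a braided monoid as a semi-cosimplicial monoid: an injection `f` sends the `i`-th
letter to the `f i`-th letter. -/
def powFunctor : SemiCosimplicialMon N C where
  obj a := powMon B a.len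
  map f := lift _ (isExchangeFamily_letter_emb B (OrdInj.Hom.toEmb f))
  map_id a := powMon_hom_ext fun i => by
    rw [letter_lift, Category.comp_id]; rfl
  map_comp f g := powMon_hom_ext fun i => by
    rw [letter_lift, ← Category.assoc, letter_lift, letter_lift]; rfl

lemma letter_powFunctor_map {a b : OrdInj N} (f : a ⟶ b) (i : Fin a.len) :
    letter B a.len i ≫ (powFunctor B N).map f = letter B b.len (OrdInj.Hom.toEmb f i) :=
  letter_lift (isExchangeFamily_letter_emb B (OrdInj.Hom.toEmb f)) i

/-- The images of the members of a covering family, listed one after the other, form a permutation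
of all indices. -/
lemma IsCoveringFamily.perm {N : ℕ∞} {n : OrdInj N} {m : ℕ} {k : Fin m → OrdInj N}
    {f : ∀ i, k i ⟶ n} (hf : IsCoveringFamily f) :
    (List.finRange n.len).Perm
      (List.ofFn fun i => List.ofFn (OrdInj.Hom.toEmb (f i))).flatten := by
  rw [List.perm_ext_iff_of_nodup (List.nodup_finRange _)]
  · intro a
    have : a ∈ ⋃ i, Set.range (OrdInj.Hom.toEmb (f i)) := hf.2 ▸ Set.mem_univ a
    simpa [List.mem_ofFn] using this
  · rw [List.nodup_flatten]
    constructor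
    · simp only [List.mem_ofFn]
      rintro _ ⟨i, rfl⟩
      exact List.nodup_ofFn.2 (OrdInj.Hom.toEmb (f i)).injective
    · rw [List.pairwise_ofFn]
      intro i j hij a ha hb
      exact Set.disjoint_left.1 (hf.1 i j hij.ne) (List.mem_ofFn.1 ha) (List.mem_ofFn.1 hb)

theorem coveringCondition_powFunctor : CoveringCondition (powFunctor B N) := by
  intro n m k f hf
  let e : Fin n.len → (A ⟶ (powMon B n.len).X) := fun i => (letter B n.len i).hom
  have h₁ : IsListProd (𝟙 (powMon B n.len).X) ((List.finRange n.len).map e) := by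
    rw [← List.ofFn_eq_map]
    have h := powMon_hom_eq (𝟙 (powMon B n.len))
    simp only [Category.comp_id] at h
    exact (isListProd_liftHom e).of_iso (Iso.refl _) (h.trans (Category.id_comp _).symm)
  -- The identity and the covering map are both products over the same permuted list of letters.
  have h₂ := h₁.trans (isListProd_of_perm B.R (isExchangeFamily_letter (B := B) n.len)
    hf.perm)
  have h₃ : IsListProd (P := (powMon B n.len).X) (coveringMap (powFunctor B N) f)
      ((List.ofFn fun i => List.ofFn (OrdInj.Hom.toEmb (f i))).flatten.map e) := by
    rw [List.map_flatten, List.map_ofFn]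
    refine isListProd_tensorFamilyHom _ _ fun i => ?_
    rw [Function.comp_apply, List.map_ofFn]
    exact isListProd_liftHom _
  exact h₃.isIso h₂ (IsIso.id _)

end

/-! ### The vertices of a complex and the braidings exchanging them -/

section
variable {A : C}

/-- The braided monoid structure with the inverse braiding. The increasing products `liftHom` need
the rule that rewrites `eⱼ ⊙ eᵢ`, `i < j`, as an increasing product; in a complex inducing `B` this
rule is given by the inverse of the braiding of `B`. -/
def BraidedMonStruct.symm (B : BraidedMonStruct A) : BraidedMonStruct A where
  mon := B.mon
  R := B.R.symm
  yang_baxter := by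
    rw [← IsIso.inv_eq_inv]
    simpa using B.yang_baxter
  one_left := by simp [← cancel_mono B.R.hom, B.one_right]
  one_right := by simp [← cancel_mono B.R.hom, B.one_left]
  mul_right := by simp [← cancel_mono B.R.hom, B.mul_left]
  mul_left := by simp [← cancel_mono B.R.hom, B.mul_right]

/-- An invertible `R` that interchanges two monoid maps `x, y` and the members of a family `a, b, c`
is a braiding as soon as the products in decreasing order are monomorphisms: each law can be checked
after composing with one of these products. -/
def BraidedMonStruct.ofExchange [MonObj A] (R : A ⊗ A ≅ A ⊗ A) {P Q : C} [MonObj P] [MonObj Q]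
    (x y : A ⟶ P) [IsMonHom x] [IsMonHom y] (hR : R.hom ≫ (y ⊙ x) = x ⊙ y) (hm : Mono (y ⊙ x))
    (a b c : A ⟶ Q) (hab : R.hom ≫ (b ⊙ a) = a ⊙ b) (hac : R.hom ≫ (c ⊙ a) = a ⊙ c)
    (hbc : R.hom ≫ (c ⊙ b) = b ⊙ c) (hm' : Mono (c ⊙ b ⊙ a)) : BraidedMonStruct A where
  mon := inferInstance
  R := R
  yang_baxter := by
    rw [← cancel_mono (α_ A A A).hom, ← cancel_mono (c ⊙ b ⊙ a)]
    simp only [Category.assoc, Iso.inv_hom_id, Category.comp_id, ← extMul_assoc,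
      whiskerRight_extMul, hbc]
    simp only [extMul_assoc, Iso.inv_hom_id_assoc, whiskerLeft_extMul, hac, hab]
    simp only [extMul_assoc', Iso.hom_inv_id_assoc, whiskerRight_extMul, hac, hab]
    simp only [extMul_assoc, Iso.inv_hom_id_assoc, whiskerLeft_extMul, hbc]
  one_left := by
    rw [← cancel_mono (y ⊙ x)]
    simp [hR, whiskerRight_extMul, whiskerLeft_extMul, one_extMul, extMul_one]
  one_right := by
    rw [← cancel_mono (y ⊙ x)]
    simp [hR, whiskerRight_extMul, whiskerLeft_extMul, one_extMul, extMul_one]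
  mul_right := by
    rw [← cancel_mono (y ⊙ x)]
    simp only [Category.assoc, hR, whiskerRight_extMul, whiskerLeft_extMul, mul_comp_eq_extMul]
    simp only [extMul_assoc, Iso.inv_hom_id_assoc, whiskerLeft_extMul, hR]
    simp only [extMul_assoc', Iso.hom_inv_id_assoc, whiskerRight_extMul, hR]
  mul_left := by
    rw [← cancel_mono (y ⊙ x)]
    simp only [Category.assoc, hR, whiskerRight_extMul, whiskerLeft_extMul, mul_comp_eq_extMul]
    simp only [extMul_assoc', Iso.hom_inv_id_assoc, whiskerRight_extMul, hR]
    simp only [extMul_assoc, Iso.inv_hom_id_assoc, whiskerLeft_extMul, hR]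
end

section familyMul

lemma tensorFamilyHom_comp {m : ℕ} {X Y Z : Fin m → C} (f : ∀ i, X i ⟶ Y i)
    (g : ∀ i, Y i ⟶ Z i) : tensorFamilyHom m (fun i => f i ≫ g i) =
      tensorFamilyHom m f ≫ tensorFamilyHom m g := by
  induction m with
  | zero => exact (Category.comp_id _).symm
  | succ m ih =>
    change (f 0 ≫ g 0) ⊗ₘ _ = (f 0 ⊗ₘ _) ≫ (g 0 ⊗ₘ _)
    rw [tensorHom_comp_tensorHom, ← ih]

lemma isIso_tensorFamilyHom {m : ℕ} {X Y : Fin m → C} (f : ∀ i, X i ⟶ Y i)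
    (h : ∀ i, IsIso (f i)) : IsIso (tensorFamilyHom m f) := by
  induction m with
  | zero => exact IsIso.id _
  | succ m ih =>
    have := h 0
    have := ih (fun i => f i.succ) fun i => h i.succ
    change IsIso (f 0 ⊗ₘ tensorFamilyHom m fun i => f i.succ)
    infer_instance

lemma tensorFamilyHom_iteratedMul_comp {P Q : C} [MonObj P] [MonObj Q] {m : ℕ} {X : Fin m → C}
    (f : ∀ i, X i ⟶ P) (g : P ⟶ Q) [IsMonHom g] :
    (tensorFamilyHom m f ≫ iteratedMul P m) ≫ g =
      tensorFamilyHom m (fun i => f i ≫ g) ≫ iteratedMul Q m := by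
  induction m with
  | zero =>
    change (𝟙 _ ≫ η[P]) ≫ g = 𝟙 _ ≫ η[Q]
    simp
  | succ m ih =>
    rw [tensorFamilyHom_iteratedMul_succ, tensorFamilyHom_iteratedMul_succ]
    exact (extMul_comp (f 0) _ g).trans (congrArg (extMul _) (ih _))

end familyMul

section vertex
variable {N : ℕ∞} [Fact (2 ≤ N)]

/-- The map `[1] ⟶ b` with value `i`. -/
def OrdInj.vertex (b : OrdInj N) (i : Fin b.len) : OrdInj.one N ⟶ b :=
  OrderEmbedding.ofStrictMono (fun _ : Fin 1 => i) fun x y h =>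
    absurd (Subsingleton.elim (α := Fin 1) x y) h.ne

lemma OrdInj.vertex_comp {b c : OrdInj N} (i : Fin b.len) (f : b ⟶ c) :
    OrdInj.vertex b i ≫ f = OrdInj.vertex c (OrdInj.Hom.toEmb f i) := rfl

lemma OrdInj.vertex_one (i : Fin 1) : OrdInj.vertex (OrdInj.one N) i = 𝟙 _ :=
  RelEmbedding.ext fun x : Fin 1 => (Subsingleton.elim (α := Fin 1) i x)

lemma OrdInj.d_zero : OrdInj.d N 0 = OrdInj.vertex (OrdInj.two N) 1 :=
  RelEmbedding.ext fun x : Fin 1 => by fin_cases x; rfl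

lemma OrdInj.d_one : OrdInj.d N 1 = OrdInj.vertex (OrdInj.two N) 0 :=
  RelEmbedding.ext fun x : Fin 1 => by fin_cases x; rfl

lemma isCoveringFamily_vertex {b : OrdInj N} {m : ℕ} {s : Fin m → Fin b.len}
    (hs : Function.Bijective s) :
    IsCoveringFamily (k := fun _ => OrdInj.one N) fun i => OrdInj.vertex b (s i) := by
  constructor
  · intro i j hij
    rw [Set.disjoint_left]
    rintro _ ⟨x, rfl⟩ ⟨y, hy⟩
    exact hij (hs.1 hy).symm
  · rw [Set.eq_univ_iff_forall]
    intro a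
    obtain ⟨i, rfl⟩ := hs.2 a
    exact Set.mem_iUnion.2 ⟨i, (0 : Fin 1), rfl⟩

variable {A : C} (M : CoveringComplex N A)

/-- The map `A ⟶ A^b` induced by the map `[1] ⟶ b` with value `i`. -/
def CoveringComplex.vertex (b : OrdInj N) (i : Fin b.len) : A ⟶ (M.toFunctor.obj b).X :=
  M.φ.inv ≫ (M.toFunctor.map (OrdInj.vertex b i)).hom

lemma CoveringComplex.vertex_map {b c : OrdInj N} (i : Fin b.len) (f : b ⟶ c) :
    M.vertex b i ≫ (M.toFunctor.map f).hom = M.vertex c (OrdInj.Hom.toEmb f i) := by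
  rw [vertex, vertex, Category.assoc, ← Mon.comp_hom', ← Functor.map_comp, OrdInj.vertex_comp]

lemma CoveringComplex.vertex_one (i : Fin 1) : M.vertex (OrdInj.one N) i = M.φ.inv := by
  rw [vertex, OrdInj.vertex_one, CategoryTheory.Functor.map_id, Mon.id_hom', Category.comp_id]

lemma CoveringComplex.pairing_zero_one :
    M.pairing 0 1 = M.vertex (OrdInj.two N) 1 ⊙ M.vertex (OrdInj.two N) 0 := by
  rw [pairing, OrdInj.d_zero, OrdInj.d_one]; rfl

lemma CoveringComplex.pairing_one_zero :
    M.pairing 1 0 = M.vertex (OrdInj.two N) 0 ⊙ M.vertex (OrdInj.two N) 1 := by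
  rw [pairing, OrdInj.d_zero, OrdInj.d_one]; rfl

lemma CoveringComplex.isIso_vertex {b : OrdInj N} {m : ℕ} {s : Fin m → Fin b.len}
    (hs : Function.Bijective s) :
    IsIso (tensorFamilyHom m (fun i => M.vertex b (s i)) ≫
      iteratedMul (M.toFunctor.obj b).X m) := by
  have h₁ := M.covering b m (fun _ => OrdInj.one N) _ (isCoveringFamily_vertex hs)
  have h₂ := isIso_tensorFamilyHom (fun _ : Fin m => M.φ.inv) fun _ => inferInstance
  have h₃ := tensorFamilyHom_comp (fun _ : Fin m => M.φ.inv)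
    fun i => (M.toFunctor.map (OrdInj.vertex b (s i))).hom
  change IsIso (tensorFamilyHom m (fun i => M.φ.inv ≫ _) ≫ _)
  rw [h₃, Category.assoc]
  exact IsIso.comp_isIso' h₂ h₁

lemma CoveringComplex.isIso_vertex_two {b : OrdInj N} {i j : Fin b.len}
    (h : Function.Bijective ![i, j]) : IsIso (M.vertex b i ⊙ M.vertex b j) := by
  have h₁ := M.isIso_vertex h
  rw [tensorFamilyHom_iteratedMul_succ, tensorFamilyHom_iteratedMul_succ] at h₁
  change IsIso (M.vertex b i ⊙ M.vertex b j ⊙ (𝟙 _ ≫ η[(M.toFunctor.obj b).X])) at h₁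
  rw [Category.id_comp, extMul_one, ← whiskerLeft_extMul] at h₁
  exact IsIso.of_isIso_comp_left (A ◁ (ρ_ A).hom) _

lemma CoveringComplex.isIso_vertex_three {b : OrdInj N} {i j k : Fin b.len}
    (h : Function.Bijective ![i, j, k]) :
    IsIso (M.vertex b i ⊙ M.vertex b j ⊙ M.vertex b k) := by
  have h₁ := M.isIso_vertex h
  rw [tensorFamilyHom_iteratedMul_succ, tensorFamilyHom_iteratedMul_succ,
    tensorFamilyHom_iteratedMul_succ] at h₁
  change IsIso (M.vertex b i ⊙ M.vertex b j ⊙ M.vertex b k ⊙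
    (𝟙 _ ≫ η[(M.toFunctor.obj b).X])) at h₁
  rw [Category.id_comp, extMul_one, ← whiskerLeft_extMul, ← whiskerLeft_extMul] at h₁
  exact IsIso.of_isIso_comp_left (A ◁ A ◁ (ρ_ A).hom) _

/-- The defining relation of the braiding, transported from the level `[2]` along `[2] ⟶ b`. -/
lemma CoveringComplex.vertex_exchange {r : A ⊗ A ⟶ A ⊗ A} (hr : r ≫ M.pairing 0 1 = M.pairing 1 0)
    {b : OrdInj N} {i j : Fin b.len} (hij : i < j) :
    r ≫ (M.vertex b j ⊙ M.vertex b i) = M.vertex b i ⊙ M.vertex b j := by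
  have hs : StrictMono (![i, j] : Fin 2 → Fin b.len) :=
    Fin.strictMono_iff_lt_succ.2 fun x => by fin_cases x; exact hij
  let f : OrdInj.two N ⟶ b := OrderEmbedding.ofStrictMono _ hs
  rw [pairing_zero_one, pairing_one_zero] at hr
  have := hr =≫ (M.toFunctor.map f).hom
  rw [Category.assoc, extMul_comp, extMul_comp, vertex_map, vertex_map] at this
  exact this

end vertex

/-! ### The braided monoid structure of a complex, and the complex of powers -/

section
variable {N : ℕ∞} [Fact (2 ≤ N)] {A : C}

namespace CoveringComplex

/-- The monoid structure of `A^1`, transported to `A`. -/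
abbrev monObj (M : CoveringComplex N A) : MonObj A := MonObj.ofIso M.φ

lemma isMonHom_inv (M : CoveringComplex N A) : letI := M.monObj; IsMonHom M.φ.inv :=
  letI := M.monObj
  { one_hom := by
      change (η[(M.toFunctor.obj (OrdInj.one N)).X] ≫ M.φ.hom) ≫ M.φ.inv = _
      simp
    mul_hom := by
      change ((M.φ.inv ⊗ₘ M.φ.inv) ≫ μ[(M.toFunctor.obj (OrdInj.one N)).X] ≫ M.φ.hom) ≫
        M.φ.inv = _
      simp }

lemma isMonHom_vertex (M : CoveringComplex N A) (b : OrdInj N) (i : Fin b.len) :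
    letI := M.monObj; IsMonHom (M.vertex b i) := by
  let := M.monObj
  have := M.isMonHom_inv
  rw [vertex]
  infer_instance

instance isIso_pairing_zero_one (M : CoveringComplex N A) : IsIso (M.pairing 0 1) := by
  rw [pairing_zero_one]
  exact M.isIso_vertex_two (show Function.Bijective ![(1 : Fin 2), 0] by decide)

instance isIso_pairing_one_zero (M : CoveringComplex N A) : IsIso (M.pairing 1 0) := by
  rw [pairing_one_zero]
  exact M.isIso_vertex_two (show Function.Bijective ![(0 : Fin 2), 1] by decide)

/-- The braiding of `A`, comparing the two products of the vertices of `A^2`. -/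
noncomputable def braiding (M : CoveringComplex N A) : A ⊗ A ≅ A ⊗ A :=
  asIso (M.pairing 1 0) ≪≫ (asIso (M.pairing 0 1)).symm

lemma braiding_pairing (M : CoveringComplex N A) :
    M.braiding.hom ≫ M.pairing 0 1 = M.pairing 1 0 := by
  simp [braiding]

/-- The braided monoid structure on `A` induced by a complex with at least the levels up to `3`. -/
noncomputable def induced (hN : 3 ≤ N) (M : CoveringComplex N A) : BraidedMonStruct A :=
  letI := M.monObj
  haveI := M.isMonHom_vertex
  let b : OrdInj N := ⟨3, hN⟩
  BraidedMonStruct.ofExchange M.braiding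
    (M.vertex (OrdInj.two N) 0) (M.vertex (OrdInj.two N) 1)
    (M.vertex_exchange M.braiding_pairing (show (0 : Fin 2) < 1 by decide))
    (M.pairing_zero_one ▸ inferInstance)
    (M.vertex b (0 : Fin 3)) (M.vertex b (1 : Fin 3)) (M.vertex b (2 : Fin 3))
    (M.vertex_exchange M.braiding_pairing (show (0 : Fin 3) < 1 by decide))
    (M.vertex_exchange M.braiding_pairing (show (0 : Fin 3) < 2 by decide))
    (M.vertex_exchange M.braiding_pairing (show (1 : Fin 3) < 2 by decide))
    (have := M.isIso_vertex_three (b := b)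
      (show Function.Bijective ![(2 : Fin 3), 1, 0] by decide); inferInstance)

lemma induces_induced (hN : 3 ≤ N) (M : CoveringComplex N A) : M.Induces (M.induced hN) where
  one := rfl
  mul := by
    change _ = (M.φ.hom ⊗ₘ M.φ.hom) ≫ (M.φ.inv ⊗ₘ M.φ.inv) ≫ _ ≫ M.φ.hom
    simp
  braiding := M.braiding_pairing

lemma Induces.unique {M : CoveringComplex N A} {B B' : BraidedMonStruct A} (h : M.Induces B)
    (h' : M.Induces B') : B = B' := by
  have hm : B.mon = B'.mon := MonObj.ext _ _ (by
    rw [← cancel_epi (M.φ.hom ⊗ₘ M.φ.hom), ← h.mul, ← h'.mul])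
  have hR : B.R = B'.R := Iso.ext (by
    rw [← cancel_mono (M.pairing 0 1), h.braiding, h'.braiding])
  cases B; cases B'; cases hm; cases hR; rfl

lemma coveringMap_naturality {N : ℕ∞} {M M' : SemiCosimplicialMon N C} (g : M ⟶ M')
    {n : OrdInj N} {m : ℕ} {k : Fin m → OrdInj N} (f : ∀ i, k i ⟶ n) :
    coveringMap M f ≫ (g.app n).hom =
      tensorFamilyHom m (fun i => (g.app (k i)).hom) ≫ coveringMap M' f := by
  rw [coveringMap, coveringMap, tensorFamilyHom_iteratedMul_comp, ← Category.assoc,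
    ← tensorFamilyHom_comp]
  simp only [← Mon.comp_hom', g.naturality]

variable {M M' : CoveringComplex N A}

/-- At level `b` both complexes are tensor powers of their level `1`, through the covering maps of
the family of all vertices. -/
lemma isIso_app_hom (g : M ⟶ M') (b : OrdInj N) : IsIso (g.toNatTrans.app b).hom := by
  have h₀ : IsIso (g.toNatTrans.app (OrdInj.one N)).hom := by
    have := g.comm
    rw [← Iso.eq_comp_inv] at this
    rw [this]
    infer_instance
  -- The covering map of all vertices, `A^1 ⊗ ⋯ ⊗ A^1 ⟶ A^b`, is natural in the complex.
  have hc := isCoveringFamily_vertex (b := b) (s := id) Function.bijective_id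
  have h₁ := M.covering _ _ _ _ hc
  have h₂ := M'.covering _ _ _ _ hc
  have h₃ := isIso_tensorFamilyHom
    (fun _ : Fin b.len => (g.toNatTrans.app (OrdInj.one N)).hom) fun _ => h₀
  have h₄ := coveringMap_naturality g.toNatTrans fun i => OrdInj.vertex b (id i)
  have h₅ := IsIso.comp_isIso' h₃ h₂
  rw [← h₄] at h₅
  exact IsIso.of_isIso_comp_left (coveringMap M.toFunctor fun i => OrdInj.vertex b (id i)) _

lemma isIso_hom (g : M ⟶ M') : IsIso g := by
  have (b : OrdInj N) : IsIso (g.toNatTrans.app b) := by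
    have : IsIso ((Mon.forget C).map (g.toNatTrans.app b)) := isIso_app_hom g b
    exact isIso_of_reflects_iso _ (Mon.forget C)
  have := NatIso.isIso_of_isIso_app g.toNatTrans
  have h : (g.toNatTrans.app (OrdInj.one N)).hom ≫ ((inv g.toNatTrans).app (OrdInj.one N)).hom =
      𝟙 _ := by
    rw [← Mon.comp_hom', ← NatTrans.comp_app, IsIso.hom_inv_id]; rfl
  have := isIso_app_hom g (OrdInj.one N)
  exact ⟨⟨inv g.toNatTrans, by
    rw [← cancel_epi (g.toNatTrans.app (OrdInj.one N)).hom, reassoc_of% h, g.comm]⟩,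
    Hom.ext (IsIso.hom_inv_id _), Hom.ext (IsIso.inv_hom_id _)⟩

lemma vertex_app (g : M ⟶ M') (b : OrdInj N) (i : Fin b.len) :
    M.vertex b i ≫ (g.toNatTrans.app b).hom = M'.vertex b i := by
  have h := g.comm
  rw [← Iso.eq_comp_inv] at h
  rw [vertex, vertex, Category.assoc, ← Mon.comp_hom', g.toNatTrans.naturality, Mon.comp_hom', h]
  simp

lemma Induces.of_hom {B : BraidedMonStruct A} (h : M'.Induces B)
    (g : M ⟶ M') : M.Induces B where
  one := by
    rw [← h.one, ← g.comm, ← Category.assoc, IsMonHom.one_hom]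
  mul := by
    rw [← g.comm, ← Category.assoc, IsMonHom.mul_hom, Category.assoc, h.mul,
      tensorHom_comp_tensorHom_assoc]
  braiding := by
    have := isIso_app_hom g (OrdInj.two N)
    rw [← cancel_mono (g.toNatTrans.app (OrdInj.two N)).hom, pairing_zero_one, pairing_one_zero,
      Category.assoc, extMul_comp, extMul_comp, vertex_app, vertex_app, ← pairing_zero_one,
      ← pairing_one_zero, h.braiding]

end CoveringComplex

section
variable (B : BraidedMonStruct A)

/-- The identity of `A^{⊗ 1} = A ⊗ 𝟙_ C` is the product of its only letter. -/
lemma letterHom_one (i : Fin 1) : letterHom B 1 i = (ρ_ A).inv := by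
  have h := powMon_hom_eq (𝟙 (powMon B 1))
  simp only [Category.comp_id] at h
  replace h : 𝟙 (A ⊗ 𝟙_ C) = (ρ_ A).hom ≫ letterHom B 1 0 :=
    h.trans (extMul_one (P := (powMon B 1).X) (letterHom B 1 0))
  rw [Subsingleton.elim i 0]
  exact ((Iso.inv_comp_eq _).2 h).symm.trans (Category.comp_id _)

lemma mul_comp_hom_of_mul_comp_inv {X Y : C} (e : X ≅ Y) (m : X ⊗ X ⟶ X) (m' : Y ⊗ Y ⟶ Y)
    (h : m' ≫ e.inv = (e.inv ⊗ₘ e.inv) ≫ m) : m ≫ e.hom = (e.hom ⊗ₘ e.hom) ≫ m' := by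
  rw [← cancel_mono e.inv, Category.assoc, Category.assoc, h, Iso.hom_inv_id, Category.comp_id,
    tensorHom_comp_tensorHom_assoc]
  simp

variable (N) in
/-- The complex of the powers of a braided monoid. -/
def powComplex : CoveringComplex N A where
  toFunctor := powFunctor B.symm N
  covering := coveringCondition_powFunctor B.symm N
  φ := ρ_ A

lemma powComplex_vertex (b : OrdInj N) (i : Fin b.len) :
    (powComplex N B).vertex b i = letterHom B.symm b.len i := by
  have h := congrArg (·.hom) (letter_powFunctor_map B.symm N (OrdInj.vertex b i) (0 : Fin 1))
  refine Eq.trans ?_ h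
  exact congrArg (· ≫ ((powFunctor B.symm N).map (OrdInj.vertex b i)).hom)
    (letterHom_one B.symm 0).symm

lemma induces_powComplex : (powComplex N B).Induces B where
  one := by
    have h : B.mon.one ≫ letterHom B.symm 1 0 = η[(powMon B.symm 1).X] :=
      (letter B.symm 1 0).isMonHom_hom.one_hom
    rw [letterHom_one] at h
    exact ((Iso.eq_comp_inv _).1 h.symm)
  mul := by
    have h : B.mon.mul ≫ letterHom B.symm 1 0 =
        (letterHom B.symm 1 0 ⊗ₘ letterHom B.symm 1 0) ≫ μ[(powMon B.symm 1).X] :=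
      (letter B.symm 1 0).isMonHom_hom.mul_hom
    rw [letterHom_one] at h
    exact mul_comp_hom_of_mul_comp_inv (ρ_ A) _ _ h
  braiding := by
    rw [CoveringComplex.pairing_zero_one, CoveringComplex.pairing_one_zero]
    rw [powComplex_vertex, powComplex_vertex]
    have h := isExchangeFamily_letter (B := B.symm) 2 0 1 (by decide)
    exact (Iso.eq_inv_comp B.R).1 h

end

end

/-! ### The equivalence of categories -/

section
variable {N : ℕ∞} [Fact (2 ≤ N)] {A : C} {B : BraidedMonStruct A} {M M' : CoveringComplex N A}

namespace CoveringComplex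

/-- The vertex `A ⟶ A^b` as a map of monoids. -/
def Induces.vertexHom (h : M.Induces B) (b : OrdInj N) (i : Fin b.len) :
    B.symm.toMon ⟶ M.toFunctor.obj b :=
  Mon.Hom.mk' (M.vertex b i)
    (by
      change B.mon.one ≫ M.φ.inv ≫ _ = _
      rw [← h.one, Category.assoc, Iso.hom_inv_id_assoc, IsMonHom.one_hom])
    (by
      have hφ : B.mon.mul ≫ M.φ.inv = (M.φ.inv ⊗ₘ M.φ.inv) ≫ μ :=
        mul_comp_hom_of_mul_comp_inv M.φ.symm _ _ h.mul
      change B.mon.mul ≫ M.φ.inv ≫ _ = ((M.φ.inv ≫ _) ⊗ₘ (M.φ.inv ≫ _)) ≫ _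
      rw [reassoc_of% hφ, IsMonHom.mul_hom, tensorHom_comp_tensorHom_assoc])

lemma Induces.isExchangeFamily (h : M.Induces B) (b : OrdInj N) :
    IsExchangeFamily (B := B.symm) (h.vertexHom b) := fun _ _ hij =>
  (Iso.eq_inv_comp B.R).2 (M.vertex_exchange h.braiding hij)

lemma Induces.letter_lift (h : M.Induces B) (b : OrdInj N) (i : Fin b.len) :
    letter B.symm b.len i ≫ lift _ (h.isExchangeFamily b) = h.vertexHom b i :=
  SemiCosimplicial.letter_lift (h.isExchangeFamily b) i

/-- The comparison map from the complex of powers, given by its universal property. -/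
def Induces.fromPowComplex (h : M.Induces B) : powComplex N B ⟶ M where
  toNatTrans :=
    { app b := lift _ (h.isExchangeFamily b)
      naturality b c f := powMon_hom_ext fun i => by
        change letter B.symm b.len i ≫ (powFunctor B.symm N).map f ≫ lift _ _ =
          letter B.symm b.len i ≫ lift _ _ ≫ M.toFunctor.map f
        have e : h.vertexHom c (OrdInj.Hom.toEmb f i) = h.vertexHom b i ≫ M.toFunctor.map f :=
          Mon.Hom.ext' (M.vertex_map i f).symm
        refine (Category.assoc _ _ _).symm.trans
          ((congrArg (· ≫ lift _ (h.isExchangeFamily c)) (letter_powFunctor_map _ N f i)).trans ?_)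
        exact (h.letter_lift c _).trans <| e.trans <|
          (congrArg (· ≫ M.toFunctor.map f) (h.letter_lift b i)).symm.trans (Category.assoc _ _ _) }
  comm := by
    have h₁ := congrArg (·.hom) (h.letter_lift (OrdInj.one N) (0 : Fin 1))
    replace h₁ : letterHom B.symm 1 0 ≫ (lift _ (h.isExchangeFamily (OrdInj.one N))).hom =
      M.vertex (OrdInj.one N) (0 : Fin 1) := h₁
    rw [letterHom_one, vertex_one] at h₁
    exact (Iso.eq_comp_inv M.φ).1 ((Iso.inv_comp_eq (ρ_ A)).1 h₁)

lemma powComplex_hom_ext (f g : powComplex N B ⟶ M) : f = g := by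
  refine Hom.ext (NatTrans.ext (funext fun b => powMon_hom_ext fun i => Mon.Hom.ext' ?_))
  have hf := vertex_app f b i
  have hg := vertex_app g b i
  rw [powComplex_vertex] at hf hg
  exact hf.trans hg.symm

lemma hom_ext (hN : 3 ≤ N) (f g : M ⟶ M') : f = g := by
  have := isIso_hom (M.induces_induced hN).fromPowComplex
  rw [← cancel_epi (M.induces_induced hN).fromPowComplex]
  exact powComplex_hom_ext _ _

/-- The functor sending a complex to the braided monoid structure that it induces. -/
noncomputable def inducedFunctor (hN : 3 ≤ N) (A : C) :
    CoveringComplex N A ⥤ Discrete (BraidedMonStruct A) where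
  obj M := ⟨M.induced hN⟩
  map {M M'} g := Discrete.eqToHom <|
    (M.induces_induced hN).unique ((M'.induces_induced hN).of_hom g)
  map_id _ := Subsingleton.elim _ _
  map_comp _ _ := Subsingleton.elim _ _

instance isEquivalence_inducedFunctor (hN : 3 ≤ N) (A : C) :
    (inducedFunctor hN A).IsEquivalence where
  faithful := ⟨fun _ => hom_ext hN _ _⟩
  full := ⟨fun {M M'} f => by
    have h : M'.Induces (M.induced hN) := by
      rw [show M.induced hN = M'.induced hN from Discrete.eq_of_hom f]
      exact M'.induces_induced hN
    have := isIso_hom (M.induces_induced hN).fromPowComplex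
    exact ⟨inv (M.induces_induced hN).fromPowComplex ≫ h.fromPowComplex,
      Subsingleton.elim _ _⟩⟩
  essSurj := ⟨fun B => ⟨powComplex N B.as, ⟨Discrete.eqToIso <|
    ((powComplex N B.as).induces_induced hN).unique (induces_powComplex B.as)⟩⟩⟩

end CoveringComplex

end

lemma CoveringComplex.Induces.truncate {A : C} {M : CoveringComplex ⊤ A} {B : BraidedMonStruct A}
    (h : M.Induces B) : ((SemiCosimplicial.truncate A).obj M).Induces B :=
  ⟨h.one, h.mul, h.braiding⟩

end SemiCosimplicial

theorem mainTheorem2 {C : Type u} [Category.{v} C] [MonoidalCategory C] (A : C) :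
    ∃ (F : SemiCosimplicial.CoveringComplex ⊤ A ≌
          Discrete (SemiCosimplicial.BraidedMonStruct A))
      (G : SemiCosimplicial.CoveringComplex 3 A ≌
          Discrete (SemiCosimplicial.BraidedMonStruct A)),
      (∀ M : SemiCosimplicial.CoveringComplex ⊤ A, M.Induces (F.functor.obj M).as) ∧
      (∀ M : SemiCosimplicial.CoveringComplex 3 A, M.Induces (G.functor.obj M).as) ∧
      (SemiCosimplicial.truncate A).IsEquivalence ∧
      Nonempty (SemiCosimplicial.truncate A ⋙ G.functor ≅ F.functor) := by
  let F := SemiCosimplicial.CoveringComplex.inducedFunctor (N := ⊤) le_top A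
  let G := SemiCosimplicial.CoveringComplex.inducedFunctor (N := 3) le_rfl A
  let e : SemiCosimplicial.truncate A ⋙ G ≅ F :=
    NatIso.ofComponents
      (fun M => Discrete.eqToIso <| (SemiCosimplicial.CoveringComplex.induces_induced le_rfl
        ((SemiCosimplicial.truncate A).obj M)).unique (M.induces_induced le_top).truncate)
      fun _ => Subsingleton.elim _ _
  have : (SemiCosimplicial.truncate A ⋙ G).IsEquivalence := Functor.isEquivalence_of_iso e.symm
  exact ⟨F.asEquivalence, G.asEquivalence,
    fun M => M.induces_induced le_top, fun M => M.induces_induced le_rfl,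
    Functor.isEquivalence_of_comp_right _ G, ⟨e⟩⟩
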